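/- Consider a base station with one transmit antenna and $M$ receive antennas, a pulse length $L\ge 1$, a noise level $\sigma_s>0$, and power allocation factors $\alpha_N,\alpha_F$ with $0\le\alpha_N<\alpha_F$ and $\alpha_N+\alpha_F=1$. For a power $p>0$ the transmitted waveform $\mathbf x=(x_1,\dots,x_L)^{\mathsf T}\in\mathbb C^{L}$ is $\mathbf x^{\mathsf T}=\sqrt p\,[\sqrt{\alpha_N},\sqrt{\alpha_F}]\,\mathbf S$, where $\mathbf S\in\mathbb C^{2\times L}$ is a random matrix of data streams with $\mathbf S\mathbf S^{\mathsf H}=L\,\mathbf I_2$ almost surely. The target response is $\mathbf g=\sum_{k=1}^{K}\beta_k\,\mathbf a(\theta_k)\in\mathbb C^M$, with deterministic angles $\theta_k$ and steering vectors $\mathbf a(\theta_k)\in\mathbb C^{M}$, and jointly circularly symmetric zero-mean complex Gaussian amplitudes $(\beta_k)$ (for instance independent $\beta_k\sim\mathcal{CN}(0,\sigma_k^2)$). The echo is $\mathbf Y_s=\mathbf g\mathbf x^{\mathsf T}+\mathbf N_s\in\mathbb C^{M\times L}$, where the entries of $\mathbf N_s$ are i.i.d. $\mathcal{CN}(0,\sigma_s^2)$,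 and $(\beta_k)$, $\mathbf N_s$, $\mathbf S$ are mutually independent. Let $\mathbf R=\mathbb E\{\mathbf g\mathbf g^{\mathsf H}\}$ be the correlation matrix of $\mathbf g$, let $r$ be its rank, and let $\lambda_1,\dots,\lambda_r$ be its positive eigenvalues, counted with multiplicity. Let $\mathcal R(p)=L^{-1}I(\mathbf Y_s;\mathbf g\mid\mathbf x)$ be the sensing rate, where $I(\cdot\,;\cdot\mid\cdot)$ is the conditional mutual information in bits. Then for every $p>0$ the sensing rate is finite and $$\mathcal R(p)=\frac1L\log_2\det\!\left(\mathbf I_M+\frac{pL}{\sigma_s^{2}}\mathbf R\right),$$ and, as $p\to\infty$, $$\mathcal R(p)-\left(\frac rL\log_2 p+\frac1L\sum_{a=1}^{r}\log_2\!\left(\frac{L\lambda_a}{\sigma_s^2}\right)\right)\longrightarrow 0 .$$ -/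

import Mathlib

open MeasureTheory ProbabilityTheory Filter
open scoped ENNReal Topology Matrix ComplexConjugate

namespace NomaIsac

/-- The random vector `Z` with entries in `ℂ` has the circularly symmetric complex Gaussian law
`CN(0, C)`: it is (jointly) Gaussian as a real random vector, has mean zero, has vanishing
pseudo-covariance `E[Z Zᵀ] = 0`, and has covariance `E[Z Zᴴ] = C`. -/
structure IsCircularGaussian {Ω ι : Type*} [MeasurableSpace Ω] [Fintype ι]
    (P : Measure Ω) (Z : Ω → ι → ℂ) (C : Matrix ι ι ℂ) : Prop where
  gaussian : HasGaussianLaw Z P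
  mean : ∀ i, ∫ ω, Z ω i ∂P = 0
  pseudoCov : ∀ i j, ∫ ω, Z ω i * Z ω j ∂P = 0
  cov : ∀ i j, ∫ ω, Z ω i * conj (Z ω j) ∂P = C i j

/-- The correlation matrix `E[g gᴴ]` of a complex random vector `g`. -/
noncomputable def correlationMatrix {Ω ι : Type*} [MeasurableSpace Ω]
    (P : Measure Ω) (g : Ω → ι → ℂ) : Matrix ι ι ℂ :=
  Matrix.of fun i j => ∫ ω, g ω i * conj (g ω j) ∂P

theorem correlationMatrix_isHermitian {Ω ι : Type*} [MeasurableSpace Ω]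
    (P : Measure Ω) (g : Ω → ι → ℂ) : (correlationMatrix P g).IsHermitian := by
  ext i j
  simp only [correlationMatrix, Matrix.conjTranspose_apply, Matrix.of_apply]
  rw [← starRingEnd_apply, ← integral_conj]
  simp [mul_comm]

/-- Conditional mutual information `I(X; Y | Z)` in nats: the average over `z ∼ Z` of the
Kullback-Leibler divergence of the conditional joint law of `(X, Y)` given `Z = z` from the
product of the conditional laws of `X` and of `Y` given `Z = z`. -/
noncomputable def condMutualInfo {Ω A B D : Type*} [MeasurableSpace Ω]
    [MeasurableSpace A] [StandardBorelSpace A] [Nonempty A]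
    [MeasurableSpace B] [StandardBorelSpace B] [Nonempty B] [MeasurableSpace D]
    (P : Measure Ω) [IsFiniteMeasure P] (X : Ω → A) (Y : Ω → B) (Z : Ω → D) : ℝ≥0∞ :=
  ∫⁻ z, InformationTheory.klDiv (condDistrib (fun ω => (X ω, Y ω)) Z P z)
    ((condDistrib X Z P z).prod (condDistrib Y Z P z)) ∂(P.map Z)

/-- The superposed waveform `xᵀ = √p [√α_N, √α_F] S`, where the rows `0` and `1` of `S` are the
data streams of the near user and of the far user. -/
noncomputable def waveform {L : ℕ} (p αN αF : ℝ) (S : Fin 2 → Fin L → ℂ) : Fin L → ℂ :=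
  ((√p : ℝ) : ℂ) • (![((√αN : ℝ) : ℂ), ((√αF : ℝ) : ℂ)] ᵥ* Matrix.of S)

/-- The target response vector `g = ∑ₖ βₖ a(θₖ)`. -/
noncomputable def targetResponse {K M : ℕ} (a : ℝ → Fin M → ℂ) (θ : Fin K → ℝ)
    (β : Fin K → ℂ) : Fin M → ℂ :=
  ∑ k, β k • a (θ k)

/-- The echo `Y = g xᵀ + N`, an `M × L` array of complex numbers. -/
def echo {M L : ℕ} (g : Fin M → ℂ) (x : Fin L → ℂ) (N : Fin M → Fin L → ℂ) :
    Fin M → Fin L → ℂ :=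
  fun m l => g m * x l + N m l

/-- The sensing rate `L⁻¹ I(Y; g | x)`, in bits per unit time, for the random target response `g`,
the random waveform `x` and the random noise `N`, where `Y = g xᵀ + N`. -/
noncomputable def sensingRate {Ω : Type*} [MeasurableSpace Ω] {M L : ℕ}
    (P : Measure Ω) [IsFiniteMeasure P] (g : Ω → Fin M → ℂ) (x : Ω → Fin L → ℂ)
    (N : Ω → Fin M → Fin L → ℂ) : ℝ≥0∞ :=
  (L : ℝ≥0∞)⁻¹ *
    (condMutualInfo P (fun ω => echo (g ω) (x ω) (N ω)) g x / ENNReal.ofReal (Real.log 2))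

end NomaIsac

/-! Given `x`, the vectorised echo is circular Gaussian with covariance `σ² I + R ⊗ xxᴴ`. Factor `I
+ σ⁻² R ⊗ xxᴴ = A Aᴴ`; since a circular Gaussian law is determined by its covariance
(`IsCircularGaussian.map_eq_map`), the echo has the law of `A n`, with `n` the noise.

The mutual information then needs no explicit Gaussian entropy (`klDiv_additive_noise`). If `f` is
the noise density, the log-likelihood ratio of the joint law against the product of the marginals is
`log f(y - h g) - log f(A⁻¹ y) + log |det A|`. The first two terms have the same mean, because `y -
h g` and `A⁻¹ y` are both distributed as `n`; only `log |det A|` remains. The law of `g` is never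
assumed to have a density, so `R` may be singular.

The real determinant of `A` is `det (A Aᴴ)` in absolute value, which Sylvester's identity reduces to
`det (I + (‖x‖²/σ²) R)`. By `sum_mul_conj_waveform`, `‖x‖² = pL` almost surely, so averaging over
`x` changes nothing. Diagonalising `R` gives `∏ (1 + pLλᵢ/σ²)`, whose logarithm yields the
asymptotics. -/

namespace NomaIsac

/-! ### Circularly symmetric Gaussian vectors: moments, uniqueness of the law, stability. -/

section CircularGaussian

variable {Ω ι : Type*} [MeasurableSpace Ω] [Fintype ι] {P : Measure Ω} {Z : Ω → ι → ℂ}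
  {C : Matrix ι ι ℂ}

theorem IsCircularGaussian.memLp_two (h : IsCircularGaussian P Z C) (i : ι) :
    MemLp (fun ω => Z ω i) 2 P :=
  (h.gaussian.map_fun (.proj i : (ι → ℂ) →L[ℝ] ℂ)).memLp_two

theorem IsCircularGaussian.integrable (h : IsCircularGaussian P Z C) (i : ι) :
    Integrable (fun ω => Z ω i) P :=
  (h.gaussian.map_fun (.proj i : (ι → ℂ) →L[ℝ] ℂ)).integrable

theorem IsCircularGaussian.integrable_mul (h : IsCircularGaussian P Z C) (i j : ι) :
    Integrable (fun ω => Z ω i * Z ω j) P :=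
  (h.memLp_two i).integrable_mul (h.memLp_two j)

theorem IsCircularGaussian.integrable_mul_conj (h : IsCircularGaussian P Z C) (i j : ι) :
    Integrable (fun ω => Z ω i * conj (Z ω j)) P :=
  (h.memLp_two i).integrable_mul (h.memLp_two j).star

/-- The mean of a linear form in a circularly symmetric Gaussian vector vanishes. -/
theorem IsCircularGaussian.integral_sum_mul (h : IsCircularGaussian P Z C) (c : ι → ℂ) :
    ∫ ω, ∑ i, c i * Z ω i ∂P = 0 := by
  rw [integral_finsetSum _ fun i _ => (h.integrable i).const_mul _]
  simp [integral_const_mul, h.mean]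

theorem IsCircularGaussian.integral_sum_mul_sum (h : IsCircularGaussian P Z C) (c d : ι → ℂ) :
    ∫ ω, (∑ i, c i * Z ω i) * (∑ j, d j * Z ω j) ∂P = 0 := by
  have e : ∀ ω, (∑ i, c i * Z ω i) * (∑ j, d j * Z ω j)
      = ∑ i, ∑ j, c i * d j * (Z ω i * Z ω j) := fun ω => by
    rw [Finset.sum_mul_sum]
    exact Finset.sum_congr rfl fun i _ => Finset.sum_congr rfl fun j _ => by ring
  simp_rw [e]
  rw [integral_finsetSum _ fun i _ => integrable_finsetSum _ fun j _ =>
    (h.integrable_mul i j).const_mul _]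
  refine Finset.sum_eq_zero fun i _ => ?_
  rw [integral_finsetSum _ fun j _ => (h.integrable_mul i j).const_mul _]
  simp [integral_const_mul, h.pseudoCov]

theorem IsCircularGaussian.integral_sum_mul_conj_sum (h : IsCircularGaussian P Z C)
    (c d : ι → ℂ) :
    ∫ ω, (∑ i, c i * Z ω i) * conj (∑ j, d j * Z ω j) ∂P
      = ∑ i, ∑ j, c i * conj (d j) * C i j := by
  have e : ∀ ω, (∑ i, c i * Z ω i) * conj (∑ j, d j * Z ω j)
      = ∑ i, ∑ j, c i * conj (d j) * (Z ω i * conj (Z ω j)) := fun ω => by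
    rw [map_sum, Finset.sum_mul_sum]
    refine Finset.sum_congr rfl fun i _ => Finset.sum_congr rfl fun j _ => ?_
    rw [map_mul]; ring
  simp_rw [e]
  rw [integral_finsetSum _ fun i _ => integrable_finsetSum _ fun j _ =>
    (h.integrable_mul_conj i j).const_mul _]
  refine Finset.sum_congr rfl fun i _ => ?_
  rw [integral_finsetSum _ fun j _ => (h.integrable_mul_conj i j).const_mul _]
  simp [integral_const_mul, h.cov]

theorem IsCircularGaussian.memLp_sum_mul (h : IsCircularGaussian P Z C) (c : ι → ℂ) :
    MemLp (fun ω => ∑ i, c i * Z ω i) 2 P :=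
  memLp_finsetSum _ fun i _ => (h.memLp_two i).const_mul _

theorem IsCircularGaussian.memLp_re_sum_mul (h : IsCircularGaussian P Z C) (c : ι → ℂ) :
    MemLp (fun ω => (∑ i, c i * Z ω i).re) 2 P :=
  (h.memLp_sum_mul c).re

theorem IsCircularGaussian.integral_re_sum_mul (h : IsCircularGaussian P Z C) (c : ι → ℂ) :
    ∫ ω, (∑ i, c i * Z ω i).re ∂P = 0 := by
  have := h.gaussian.isProbabilityMeasure
  have e := integral_re ((h.memLp_sum_mul c).integrable (by norm_num))
  simp only [RCLike.re_eq_complex_re] at e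
  rw [e, h.integral_sum_mul, Complex.zero_re]

/-- From `Re u · Re v = Re (uv + u v̄) / 2`: the mean of `uv` vanishes by circular symmetry, so half
of the Hermitian term is left. -/
theorem IsCircularGaussian.covariance_re_sum_mul (h : IsCircularGaussian P Z C) (c d : ι → ℂ) :
    cov[fun ω => (∑ i, c i * Z ω i).re, fun ω => (∑ i, d i * Z ω i).re; P]
      = (∑ i, ∑ j, c i * conj (d j) * C i j).re / 2 := by
  have := h.gaussian.isProbabilityMeasure
  rw [covariance_eq_sub (h.memLp_re_sum_mul c) (h.memLp_re_sum_mul d), h.integral_re_sum_mul,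
    zero_mul, sub_zero]
  have h1 : Integrable (fun ω => (∑ i, c i * Z ω i) * (∑ j, d j * Z ω j)) P :=
    (h.memLp_sum_mul c).integrable_mul (h.memLp_sum_mul d)
  have h2 : Integrable (fun ω => (∑ i, c i * Z ω i) * conj (∑ j, d j * Z ω j)) P :=
    (h.memLp_sum_mul c).integrable_mul (h.memLp_sum_mul d).star
  have e := integral_re (h1.add h2)
  simp only [RCLike.re_eq_complex_re, Pi.add_apply] at e
  rw [integral_add h1 h2, h.integral_sum_mul_sum, zero_add, h.integral_sum_mul_conj_sum] at e
  rw [← e, ← integral_div]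
  refine integral_congr_ae (.of_forall fun ω => ?_)
  simp only [Pi.mul_apply, Complex.add_re, Complex.mul_re, Complex.conj_re, Complex.conj_im]
  ring

/-- Every real-linear functional on `ℂ^ι` is the real part of a complex-linear one. -/
theorem exists_eq_re_sum_mul [DecidableEq ι] (T : StrongDual ℝ (ι → ℂ)) :
    ∃ c : ι → ℂ, ∀ z, T z = (∑ i, c i * z i).re := by
  -- The coefficient is `T(eᵢ) - i T(i eᵢ)`, because `Re ((a - ib)(x + iy)) = ax + by`.
  refine ⟨fun i => ⟨T (Pi.single i 1), - T (Pi.single i Complex.I)⟩, fun z => ?_⟩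
  have hz : z =
      ∑ i, ((z i).re • (Pi.single i 1 : ι → ℂ) + (z i).im • (Pi.single i Complex.I : ι → ℂ)) := by
    ext j
    simp only [Finset.sum_apply, Pi.add_apply, Pi.smul_apply, Pi.single_apply, smul_ite, smul_zero,
      Finset.sum_add_distrib, Finset.sum_ite_eq, Finset.mem_univ, if_true, Complex.real_smul,
      mul_one]
    exact (Complex.re_add_im (z j)).symm
  conv_lhs => rw [hz]
  simp only [map_sum, map_add, map_smul, smul_eq_mul, Complex.re_sum, Complex.mul_re]
  exact Finset.sum_congr rfl fun i _ => by ring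

/-- A circularly symmetric Gaussian law is determined by its covariance matrix. -/
theorem IsCircularGaussian.map_eq_map {Ω' : Type*} [MeasurableSpace Ω'] {P' : Measure Ω'}
    {Z' : Ω' → ι → ℂ} (h : IsCircularGaussian P Z C) (h' : IsCircularGaussian P' Z' C) :
    P.map Z = P'.map Z' := by
  classical
  have := h.gaussian.isGaussian_map
  have := h'.gaussian.isGaussian_map
  refine Measure.ext_of_charFunDual (funext fun T => ?_)
  obtain ⟨c, hc⟩ := exists_eq_re_sum_mul T
  -- A Gaussian characteristic function involves only the mean and variance of each real functional,
  -- and both are determined by `C`.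
  rw [h.gaussian.charFunDual_map_eq_fun, h'.gaussian.charFunDual_map_eq_fun]
  simp_rw [hc]
  rw [h.integral_re_sum_mul, h'.integral_re_sum_mul, ← covariance_self, ← covariance_self,
    h.covariance_re_sum_mul, h'.covariance_re_sum_mul]
  · exact (h'.memLp_re_sum_mul c).aestronglyMeasurable.aemeasurable
  · exact (h.memLp_re_sum_mul c).aestronglyMeasurable.aemeasurable

/-- Linear images of circularly symmetric Gaussian vectors. -/
theorem IsCircularGaussian.mulVec {κ : Type*} [Fintype κ] (h : IsCircularGaussian P Z C)
    (A : Matrix κ ι ℂ) : IsCircularGaussian P (fun ω => A *ᵥ Z ω) (A * C * Aᴴ) where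
  gaussian := h.gaussian.map_fun
    (LinearMap.toContinuousLinearMap (A.mulVecLin.restrictScalars ℝ))
  mean i := h.integral_sum_mul _
  pseudoCov i j := h.integral_sum_mul_sum _ _
  cov i j := by
    refine (h.integral_sum_mul_conj_sum (A i) (A j)).trans ?_
    simp only [Matrix.mul_apply, Matrix.conjTranspose_apply, Finset.sum_mul]
    rw [Finset.sum_comm]
    exact Finset.sum_congr rfl fun k _ => Finset.sum_congr rfl fun l _ => by
      rw [← starRingEnd_apply]; ring

/-- Sums of independent circularly symmetric Gaussian vectors. -/
theorem IsCircularGaussian.add {W : Ω → ι → ℂ} {C' : Matrix ι ι ℂ}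
    (h : IsCircularGaussian P Z C) (h' : IsCircularGaussian P W C') (hZW : IndepFun Z W P) :
    IsCircularGaussian P (fun ω => Z ω + W ω) (C + C') := by
  have hind (i j : ι) : IndepFun (fun ω => Z ω i) (fun ω => W ω j) P :=
    hZW.comp (measurable_pi_apply i) (measurable_pi_apply j)
  have hZW1 (i j) : Integrable (fun ω => Z ω i * W ω j) P :=
    (h.memLp_two i).integrable_mul (h'.memLp_two j)
  have hZW2 (i j) : Integrable (fun ω => Z ω i * conj (W ω j)) P :=
    (h.memLp_two i).integrable_mul (h'.memLp_two j).star
  have hWZ2 (i j) : Integrable (fun ω => W ω i * conj (Z ω j)) P :=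
    (h'.memLp_two i).integrable_mul (h.memLp_two j).star
  have e1 (i j) : ∫ ω, Z ω i * W ω j ∂P = 0 := by
    rw [(hind i j).integral_fun_mul_eq_mul_integral (h.integrable i).aestronglyMeasurable
      (h'.integrable j).aestronglyMeasurable, h.mean, zero_mul]
  have e2 (i j) : ∫ ω, Z ω i * conj (W ω j) ∂P = 0 := by
    have : IndepFun (fun ω => Z ω i) (fun ω => conj (W ω j)) P :=
      (hind i j).comp measurable_id Complex.continuous_conj.measurable
    rw [this.integral_fun_mul_eq_mul_integral (h.integrable i).aestronglyMeasurable
      (h'.memLp_two j).star.aestronglyMeasurable]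
    simp [h.mean]
  have e3 (i j) : ∫ ω, W ω i * conj (Z ω j) ∂P = 0 := by
    have := e2 j i
    apply_fun conj at this
    rw [← integral_conj] at this
    simpa [mul_comm] using this
  refine ⟨(hZW.hasGaussianLaw h.gaussian h'.gaussian).fun_add, fun i => ?_, fun i j => ?_,
    fun i j => ?_⟩
  · simp only [Pi.add_apply]
    rw [integral_add (h.integrable i) (h'.integrable i), h.mean, h'.mean, add_zero]
  · have : ∀ ω, (Z ω + W ω) i * (Z ω + W ω) j
        = (Z ω i * Z ω j + Z ω i * W ω j) + (Z ω j * W ω i + W ω i * W ω j) := fun ω => by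
      simp only [Pi.add_apply]; ring
    simp_rw [this]
    have p : Integrable (fun ω => Z ω i * Z ω j + Z ω i * W ω j) P :=
      (h.integrable_mul i j).add (hZW1 i j)
    have q : Integrable (fun ω => Z ω j * W ω i + W ω i * W ω j) P :=
      (hZW1 j i).add (h'.integrable_mul i j)
    rw [integral_add p q, integral_add (h.integrable_mul i j) (hZW1 i j),
      integral_add (hZW1 j i) (h'.integrable_mul i j), e1, e1, h.pseudoCov, h'.pseudoCov]
    simp
  · have : ∀ ω, (Z ω + W ω) i * conj ((Z ω + W ω) j)
        = (Z ω i * conj (Z ω j) + Z ω i * conj (W ω j))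
          + (W ω i * conj (Z ω j) + W ω i * conj (W ω j)) := fun ω => by
      simp only [Pi.add_apply, map_add]; ring
    simp_rw [this]
    have p : Integrable (fun ω => Z ω i * conj (Z ω j) + Z ω i * conj (W ω j)) P :=
      (h.integrable_mul_conj i j).add (hZW2 i j)
    have q : Integrable (fun ω => W ω i * conj (Z ω j) + W ω i * conj (W ω j)) P :=
      (hWZ2 i j).add (h'.integrable_mul_conj i j)
    rw [integral_add p q,
      integral_add (h.integrable_mul_conj i j) (hZW2 i j),
      integral_add (hWZ2 i j) (h'.integrable_mul_conj i j), e2, e3, h.cov, h'.cov]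
    simp

end CircularGaussian

/-! ### Mutual information across an additive noise channel. -/

section AdditiveNoise

theorem map_withDensity_comp {α β : Type*} [MeasurableSpace α] [MeasurableSpace β]
    (m : Measure α) {T : α → β} (hT : Measurable T) {F : β → ℝ≥0∞} (hF : Measurable F) :
    (m.withDensity (F ∘ T)).map T = (m.map T).withDensity F := by
  ext s hs
  rw [Measure.map_apply hT hs, withDensity_apply _ (hT hs), withDensity_apply _ hs,
    setLIntegral_map hs hF hT]
  rfl

/-- `γ` has a positive density with respect to some additive Haar measure, and the logarithm of
this density is `γ`-integrable, so that the differential entropy of `γ` is finite. -/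
def HasFiniteEntropyDensity {E : Type*} [NormedAddCommGroup E] [NormedSpace ℝ E]
    [MeasurableSpace E] [BorelSpace E] (γ : Measure E) : Prop :=
  ∃ (m : Measure E) (f : E → ℝ), m.IsAddHaarMeasure ∧ Measurable f ∧ (∀ x, 0 < f x) ∧
    γ = m.withDensity (fun x => ENNReal.ofReal (f x)) ∧ Integrable (fun x => Real.log (f x)) γ

theorem HasFiniteEntropyDensity.map_equiv {E F : Type*}
    [NormedAddCommGroup E] [NormedSpace ℝ E] [MeasurableSpace E] [BorelSpace E]
    [NormedAddCommGroup F] [NormedSpace ℝ F] [MeasurableSpace F] [BorelSpace F]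
    {γ : Measure E} (h : HasFiniteEntropyDensity γ)
    (e : E ≃L[ℝ] F) : HasFiniteEntropyDensity (γ.map e) := by
  obtain ⟨m, f, hm, hf, hpos, rfl, hint⟩ := h
  have he : Measurable e := e.continuous.measurable
  have hes : Measurable e.symm := e.symm.continuous.measurable
  have hfe : Measurable fun x => f (e.symm x) := hf.comp hes
  have hlog : Measurable fun x => Real.log (f (e.symm x)) := Real.measurable_log.comp hfe
  refine ⟨m.map e, fun x => f (e.symm x), e.isAddHaarMeasure_map m, hf.comp hes,
    fun x => hpos _, ?_, ?_⟩
  · rw [← map_withDensity_comp m he hfe.ennreal_ofReal]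
    simp [Function.comp_def]
  · rw [integrable_map_measure hlog.aestronglyMeasurable
      he.aemeasurable]
    simpa [Function.comp_def] using hint

variable {E G : Type*} [NormedAddCommGroup E] [NormedSpace ℝ E] [FiniteDimensional ℝ E]
  [MeasurableSpace E] [BorelSpace E] [MeasurableSpace G]

/-- The mutual information between `g` and `h g + n`, where the noise `n` is independent of `g`
and `h g + n` has the law of a linear image `A n` of the noise, is `log |det A|`. -/
theorem klDiv_additive_noise {γ : Measure E} [IsProbabilityMeasure γ]
    (hγ : HasFiniteEntropyDensity γ) (μ : Measure G) [IsProbabilityMeasure μ]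
    {h : G → E} (hh : Measurable h) (A : E →ₗ[ℝ] E) (hA : LinearMap.det A ≠ 0)
    (hY : (γ.prod μ).map (fun q => h q.2 + q.1) = γ.map A) :
    InformationTheory.klDiv ((γ.prod μ).map (fun q => (h q.2 + q.1, q.2))) ((γ.map A).prod μ)
      = ENNReal.ofReal (Real.log |LinearMap.det A|) := by
  obtain ⟨m, f, hm, hf, hpos, hγf, hint⟩ := hγ
  have hAm : Measurable A := A.continuous_of_finiteDimensional.measurable
  set B : E ≃ₗ[ℝ] E := LinearEquiv.ofIsUnitDet (f := A) (v := Module.finBasis ℝ E)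
    (v' := Module.finBasis ℝ E) (by rw [LinearMap.det_toMatrix]; exact hA.isUnit) with hB
  have hBA : ∀ x, B.symm (A x) = x := fun x => B.symm_apply_apply x
  have hBm : Measurable B.symm :=
    (B.symm : E →ₗ[ℝ] E).continuous_of_finiteDimensional.measurable
  set T : E × G → E × G := fun q => (h q.2 + q.1, q.2) with hT
  have hTm : Measurable T := by fun_prop
  -- `T` is a shear: on each fibre over `g` it translates by `h g`, which preserves Haar measure.
  have hpT : (m.prod μ).map T = m.prod μ := by
    ext s hs
    rw [Measure.map_apply hTm hs, Measure.prod_apply_symm (hTm hs), Measure.prod_apply_symm hs]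
    refine lintegral_congr fun g => ?_
    exact measure_preimage_add m (h g) ((fun x => (x, g)) ⁻¹' s)
  -- `c` is the Jacobian factor in the density of `γ.map A`. `F₁` and `F₂` are the densities of the
  -- joint law and of the product of marginals, both with respect to `m.prod μ`.
  set c : ℝ := |(LinearMap.det A)⁻¹| with hc
  have hcpos : 0 < c := abs_pos.2 (inv_ne_zero hA)
  set J := (γ.prod μ).map T with hJ
  set F₁ : E × G → ℝ := fun q => f (q.1 - h q.2) with hF₁
  set F₂ : E × G → ℝ := fun q => c * f (B.symm q.1) with hF₂
  have hF₁m : Measurable F₁ := by fun_prop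
  have hF₂m : Measurable F₂ := by fun_prop
  have hF₁p : ∀ q, 0 < F₁ q := fun q => hpos _
  have hF₂p : ∀ q, 0 < F₂ q := fun q => mul_pos hcpos (hpos _)
  have hJm : J = (m.prod μ).withDensity (fun q => ENNReal.ofReal (F₁ q)) := by
    rw [hJ, hγf, prod_withDensity_left hf.ennreal_ofReal]
    conv_rhs => rw [← hpT]
    rw [← map_withDensity_comp _ hTm hF₁m.ennreal_ofReal]
    simp [Function.comp_def, hF₁, hT]
  have hfB : Measurable fun y => f (B.symm y) := hf.comp hBm
  have hQm : (γ.map A).prod μ = (m.prod μ).withDensity (fun q => ENNReal.ofReal (F₂ q)) := by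
    have e : γ.map A = m.withDensity (fun y => ENNReal.ofReal (c * f (B.symm y))) := by
      have e1 : (fun x => ENNReal.ofReal (f x)) = (fun y => ENNReal.ofReal (f (B.symm y))) ∘ A := by
        funext x; simp [hBA]
      rw [hγf, e1, map_withDensity_comp m hAm hfB.ennreal_ofReal,
        Measure.map_linearMap_addHaar_eq_smul_addHaar m hA, withDensity_smul_measure,
        ← withDensity_smul _ hfB.ennreal_ofReal]
      congr 1; funext y
      rw [Pi.smul_apply, smul_eq_mul, ENNReal.ofReal_mul hcpos.le]
    rw [e]
    exact prod_withDensity_left (hfB.const_mul c).ennreal_ofReal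
  have : IsProbabilityMeasure (γ.map A) := Measure.isProbabilityMeasure_map hAm.aemeasurable
  have : IsProbabilityMeasure J := Measure.isProbabilityMeasure_map hTm.aemeasurable
  set Q := (γ.map A).prod μ with hQ
  have hFm : Measurable fun q => F₁ q / F₂ q := hF₁m.div hF₂m
  have hJQ : J = Q.withDensity (fun q => ENNReal.ofReal (F₁ q / F₂ q)) := by
    rw [hJm, hQm, ← withDensity_mul _ hF₂m.ennreal_ofReal hFm.ennreal_ofReal]
    congr 1; funext q
    rw [Pi.mul_apply, ← ENNReal.ofReal_mul (hF₂p q).le, mul_div_cancel₀ _ (hF₂p q).ne']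
  have hac : J ≪ Q := hJQ ▸ withDensity_absolutelyContinuous _ _
  have hrn : J.rnDeriv Q =ᵐ[J] fun q => ENNReal.ofReal (F₁ q / F₂ q) :=
    hac.ae_le (by
      rw [hJQ]
      exact Measure.rnDeriv_withDensity Q hFm.ennreal_ofReal)
  have hllr : llr J Q =ᵐ[J] fun q => Real.log (f (q.1 - h q.2)) - Real.log (f (B.symm q.1))
      + Real.log |LinearMap.det A| := by
    filter_upwards [hrn] with q hq
    rw [llr_def]
    simp only
    rw [hq, ENNReal.toReal_ofReal (div_pos (hF₁p q) (hF₂p q)).le,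
      Real.log_div (hF₁p q).ne' (hF₂p q).ne', hF₁, hF₂]
    simp only
    rw [Real.log_mul hcpos.ne' (hpos _).ne', hc, abs_inv, Real.log_inv]
    ring
  have hlogf : Measurable fun x => Real.log (f x) := Real.measurable_log.comp hf
  have m₁ : Measurable fun q : E × G => Real.log (f (q.1 - h q.2)) :=
    hlogf.comp (measurable_fst.sub (hh.comp measurable_snd))
  have m₂ : Measurable fun y => Real.log (f (B.symm y)) := hlogf.comp hBm
  have i₁ : Integrable (fun q => Real.log (f (q.1 - h q.2))) J := by
    rw [hJ, integrable_map_measure m₁.aestronglyMeasurable hTm.aemeasurable]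
    simpa [Function.comp_def, hT] using hint.comp_fst μ
  have v₁ : ∫ q, Real.log (f (q.1 - h q.2)) ∂J = ∫ x, Real.log (f x) ∂γ := by
    rw [hJ, integral_map hTm.aemeasurable m₁.aestronglyMeasurable]
    simp only [hT, add_sub_cancel_left]
    rw [integral_fun_fst (μ := γ) (ν := μ) (fun x => Real.log (f x))]
    simp
  -- This is where `hY` enters: under `J` the first coordinate is distributed as `A n`, so `B.symm`
  -- brings it back to `γ` and the two log-density integrals cancel.
  have hJ1 : J.map Prod.fst = γ.map A := by
    rw [hJ, Measure.map_map measurable_fst hTm, ← hY]; rfl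
  have i₂' : Integrable (fun y => Real.log (f (B.symm y))) (J.map Prod.fst) := by
    rw [hJ1, integrable_map_measure m₂.aestronglyMeasurable hAm.aemeasurable]
    simpa [Function.comp_def, hBA] using hint
  have i₂ : Integrable (fun q => Real.log (f (B.symm q.1))) J :=
    i₂'.comp_measurable measurable_fst
  have v₂ : ∫ q, Real.log (f (B.symm q.1)) ∂J = ∫ x, Real.log (f x) ∂γ := by
    rw [← integral_map (φ := Prod.fst) (f := fun y => Real.log (f (B.symm y)))
      measurable_fst.aemeasurable m₂.aestronglyMeasurable,
      hJ1, integral_map hAm.aemeasurable m₂.aestronglyMeasurable]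
    simp only [hBA]
  have i₃ : Integrable (fun q => Real.log (f (q.1 - h q.2)) - Real.log (f (B.symm q.1))) J :=
    i₁.sub i₂
  rw [InformationTheory.klDiv_of_ac_of_integrable hac
    ((i₃.add (integrable_const _)).congr hllr.symm), integral_congr_ae hllr,
    integral_add i₃ (integrable_const _), integral_sub i₁ i₂, v₁, v₂]
  simp

end AdditiveNoise

/-! ### Conditioning on an independent variable. -/

section IndepCondDistrib

/-- Independence lets conditioning freeze `X` at `d` while `W` keeps its law; Fubini shows that this
kernel disintegrates the joint law. Uniqueness of disintegrations holds only almost everywhere. -/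
theorem condDistrib_comp_of_indepFun {Ω A B D : Type*} [MeasurableSpace Ω]
    [MeasurableSpace A] [StandardBorelSpace A] [Nonempty A] [MeasurableSpace B]
    [MeasurableSpace D] {P : Measure Ω} [IsProbabilityMeasure P] {X : Ω → D} {W : Ω → B}
    (hX : AEMeasurable X P) (hW : AEMeasurable W P) (hXW : IndepFun X W P)
    {φ : D × B → A} (hφ : Measurable φ) :
    ∀ᵐ d ∂(P.map X), condDistrib (fun ω => φ (X ω, W ω)) X P d
      = (P.map W).map (fun w => φ (d, w)) := by
  have := Measure.isProbabilityMeasure_map hX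
  have := Measure.isProbabilityMeasure_map hW
  let κ : Kernel D A := (Kernel.id ×ₖ Kernel.const D (P.map W)).map φ
  have hκ : ∀ d, κ d = (P.map W).map (fun w => φ (d, w)) := fun d => by
    simp only [κ]
    rw [Kernel.map_apply _ hφ, Kernel.prod_apply, Kernel.id_apply, Kernel.const_apply,
      Measure.dirac_prod, Measure.map_map hφ (by fun_prop)]
    rfl
  have : IsMarkovKernel κ := Kernel.IsMarkovKernel.map _ hφ
  have key : condDistrib (fun ω => φ (X ω, W ω)) X P =ᵐ[P.map X] κ := by
    have hφ' : AEMeasurable (fun ω => φ (X ω, W ω)) P := hφ.comp_aemeasurable (hX.prodMk hW)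
    refine condDistrib_ae_eq_of_measure_eq_compProd X hφ' ?_
    have e : P.map (fun ω => (X ω, φ (X ω, W ω)))
        = ((P.map X).prod (P.map W)).map (fun q => (q.1, φ q)) := by
      rw [← (indepFun_iff_map_prod_eq_prod_map_map hX hW).1 hXW,
        AEMeasurable.map_map_of_aemeasurable (by fun_prop) (hX.prodMk hW)]
      rfl
    rw [e]
    ext s hs
    have hm : Measurable fun q : D × B => (q.1, φ q) := by fun_prop
    rw [Measure.map_apply hm hs, Measure.prod_apply (hm hs), Measure.compProd_apply hs]
    refine lintegral_congr fun d => ?_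
    rw [hκ, Measure.map_apply (f := fun w => φ (d, w)) (by fun_prop) (measurable_prodMk_left hs)]
    rfl
  filter_upwards [key] with d hd
  rw [hd, hκ]

end IndepCondDistrib

/-! ### Density of white complex Gaussian noise. -/

section Density

open scoped NNReal

theorem pi_gaussianReal_eq_withDensity {κ : Type*} [Fintype κ] {v : ℝ≥0} (hv : v ≠ 0) :
    Measure.pi (fun _ : κ => gaussianReal 0 v)
      = volume.withDensity (fun x => ENNReal.ofReal (∏ i, gaussianPDFReal 0 v (x i))) := by
  refine Measure.pi_eq fun s hs => ?_
  have hint : Integrable (fun x : κ → ℝ => ∏ i, gaussianPDFReal 0 v (x i)) volume :=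
    Integrable.fintype_prod fun _ => integrable_gaussianPDFReal 0 v
  rw [withDensity_apply _ (MeasurableSet.univ_pi hs), ← ofReal_integral_eq_lintegral_ofReal
    hint.integrableOn (.of_forall fun x => Finset.prod_nonneg fun i _ =>
      gaussianPDFReal_nonneg _ _ _), volume_pi, Measure.restrict_pi_pi,
    integral_fintype_prod_eq_prod (fun _ => gaussianPDFReal 0 v),
    ENNReal.ofReal_prod_of_nonneg fun i _ => integral_nonneg fun x => gaussianPDFReal_nonneg _ _ _]
  exact Finset.prod_congr rfl fun i _ => (gaussianReal_apply_eq_integral 0 hv (s i)).symm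

/-- The log-density is a constant minus a multiple of a sum of squares, integrable because Gaussians
have second moments. -/
theorem hasFiniteEntropyDensity_pi_gaussianReal {κ : Type*} [Fintype κ] {v : ℝ≥0} (hv : v ≠ 0) :
    HasFiniteEntropyDensity (Measure.pi (fun _ : κ => gaussianReal 0 v)) := by
  have hpos : ∀ x : ℝ, 0 < gaussianPDFReal 0 v x := fun x => gaussianPDFReal_pos 0 v x hv
  refine ⟨volume, fun x => ∏ i, gaussianPDFReal 0 v (x i), inferInstance, ?_,
    fun x => Finset.prod_pos fun i _ => hpos _, pi_gaussianReal_eq_withDensity hv, ?_⟩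
  · exact Finset.measurable_prod _ fun i _ =>
      (measurable_gaussianPDFReal 0 v).comp (measurable_pi_apply i)
  simp_rw [Real.log_prod fun i (_ : i ∈ Finset.univ) => (hpos _).ne']
  refine integrable_finsetSum _ fun i _ => ?_
  have hlog : Integrable (fun x => Real.log (gaussianPDFReal 0 v x)) (gaussianReal 0 v) := by
    have e : (fun x => Real.log (gaussianPDFReal 0 v x))
        = fun x => Real.log (√(2 * Real.pi * v))⁻¹ - (2 * (v : ℝ))⁻¹ * x ^ 2 := by
      funext x
      have hv' : (0 : ℝ) < v := by positivity
      rw [gaussianPDFReal_def, Real.log_mul (by positivity) (Real.exp_pos _).ne', Real.log_exp]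
      simp only [sub_zero]
      ring
    rw [e]
    have h2 : MemLp (id : ℝ → ℝ) 2 (gaussianReal 0 v) := by
      exact_mod_cast memLp_id_gaussianReal (μ := 0) (v := v) 2
    exact (integrable_const _).sub (h2.integrable_sq.const_mul _)
  exact integrable_comp_eval (μ := fun _ : κ => gaussianReal 0 v) (i := i) hlog

/-- The real and imaginary parts of the entries of a complex vector. -/
noncomputable def realCoordinates (ι : Type*) [Fintype ι] : (ι → ℂ) ≃L[ℝ] (ι × Fin 2 → ℝ) :=
  LinearEquiv.toContinuousLinearEquiv
    { toFun := fun z q => (![1, -Complex.I] q.2 * z q.1).re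
      invFun := fun x i => ⟨x (i, 0), x (i, 1)⟩
      map_add' := fun z w => by ext q; simp [mul_add]
      map_smul' := fun r z => by ext q; simp [mul_left_comm]
      left_inv := fun z => by ext i; simp
      right_inv := fun x => by ext ⟨i, b⟩; fin_cases b <;> simp }

theorem realCoordinates_apply {ι : Type*} [Fintype ι] (z : ι → ℂ) (q : ι × Fin 2) :
    realCoordinates ι z q = (![1, -Complex.I] q.2 * z q.1).re := rfl

theorem IsCircularGaussian.hasFiniteEntropyDensity {Ω ι : Type*} [MeasurableSpace Ω] [Fintype ι]
    [DecidableEq ι] {P : Measure Ω} {Z : Ω → ι → ℂ} {s : ℝ} (hs : 0 < s)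
    (h : IsCircularGaussian P Z ((s : ℂ) • (1 : Matrix ι ι ℂ))) :
    HasFiniteEntropyDensity (P.map Z) := by
  have := h.gaussian.isProbabilityMeasure
  set X : ι × Fin 2 → Ω → ℝ := fun q ω => realCoordinates ι (Z ω) q with hX
  -- Since `Im z = Re (-i z)`, every real coordinate is the real part of a complex-linear form, so
  -- `covariance_re_sum_mul` applies. The coordinates are uncorrelated with variance `s / 2`, hence
  -- independent by joint Gaussianity.
  set c : ι × Fin 2 → ι → ℂ := fun q => Pi.single q.1 (![1, -Complex.I] q.2) with hc
  have hXc : ∀ q, X q = fun ω => (∑ i, c q i * Z ω i).re := fun q => by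
    funext ω
    simp [hX, hc, realCoordinates_apply, Pi.single_apply]
  have hXg : HasGaussianLaw (fun ω q => X q ω) P :=
    h.gaussian.map_fun (realCoordinates ι).toContinuousLinearMap
  have hcov : ∀ q q', cov[X q, X q'; P] = if q = q' then s / 2 else 0 := fun q q' => by
    rw [hXc, hXc, h.covariance_re_sum_mul]
    obtain ⟨i, b⟩ := q
    obtain ⟨j, b'⟩ := q'
    have : ∑ k, ∑ l, c (i, b) k * conj (c (j, b') l) * ((s : ℂ) • (1 : Matrix ι ι ℂ)) k l
        = if i = j then ![1, -Complex.I] b * conj (![1, -Complex.I] b') * s else 0 := by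
      rw [Finset.sum_eq_single i _ (by simp), Finset.sum_eq_single j _ (by simp)]
      · simp [hc, Matrix.one_apply]
      · intro l _ hl
        simp [hc, hl]
      · intro k _ hk
        simp [hc, Pi.single_apply, hk]
    rw [this]
    by_cases hij : i = j
    · fin_cases b <;> fin_cases b' <;> simp [hij]
    · simp [hij]
  have hlaw : P.map (fun ω q => X q ω)
      = Measure.pi (fun _ : ι × Fin 2 => gaussianReal 0 (s / 2).toNNReal) := by
    have hind := hXg.iIndepFun_of_covariance_eq_zero fun q q' hq => by rw [hcov, if_neg hq]
    rw [(iIndepFun_iff_map_fun_eq_pi_map fun q => (hXg.eval q).aemeasurable).1 hind]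
    congr 1
    funext q
    rw [(hXg.eval q).map_eq_gaussianReal, ← covariance_self (hXg.eval q).aemeasurable, hcov,
      if_pos rfl, hXc, h.integral_re_sum_mul]
  have hv : (s / 2).toNNReal ≠ 0 := (Real.toNNReal_pos.2 (by positivity)).ne'
  have key := (hasFiniteEntropyDensity_pi_gaussianReal (κ := ι × Fin 2) hv).map_equiv
    (realCoordinates ι).symm
  rw [← hlaw, AEMeasurable.map_map_of_aemeasurable
    (realCoordinates ι).symm.continuous.measurable.aemeasurable hXg.aemeasurable] at key
  convert key using 2
  funext ω
  exact ((realCoordinates ι).symm_apply_apply (Z ω)).symm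

end Density

/-! ### Determinant identities. -/

section LinearAlgebra

open scoped ComplexOrder in
theorem exists_eq_mul_conjTranspose_of_posSemidef {n : Type*} [Fintype n] [DecidableEq n]
    {D : Matrix n n ℂ} (hD : D.PosSemidef) : ∃ A : Matrix n n ℂ, D = A * Aᴴ := by
  open scoped MatrixOrder Matrix.Norms.L2Operator in
  obtain ⟨B, hB⟩ := CStarAlgebra.nonneg_iff_eq_star_mul_self.mp hD.nonneg
  exact ⟨Bᴴ, by rw [hB, Matrix.conjTranspose_conjTranspose, Matrix.star_eq_conjTranspose]⟩

theorem abs_det_restrictScalars_toLin' {n : Type*} [Fintype n] [DecidableEq n]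
    (A : Matrix n n ℂ) :
    ((|LinearMap.det ((Matrix.toLin' A).restrictScalars ℝ)| : ℝ) : ℂ) = (A * Aᴴ).det := by
  rw [LinearMap.det_restrictScalars, Algebra.norm_complex_eq, LinearMap.det_toLin',
    Matrix.det_mul, Matrix.det_conjTranspose, ← starRingEnd_apply, Complex.mul_conj]
  simp [abs_of_nonneg (Complex.normSq_nonneg _)]

/-- Factor `R ⊗ x yᵀ = (R ⊗ x)(I ⊗ yᵀ)` and swap the factors by Sylvester's identity; the product in
the other order is `(y ⬝ᵥ x) • R`. -/
theorem det_one_add_kronecker_vecMulVec {m n : Type*} [Fintype m] [DecidableEq m] [Fintype n]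
    [DecidableEq n] (R : Matrix m m ℂ) (x y : n → ℂ) :
    (1 + Matrix.kroneckerMap (· * ·) R (Matrix.vecMulVec x y)).det = (1 + (y ⬝ᵥ x) • R).det := by
  have h1 : Matrix.kroneckerMap (· * ·) R (Matrix.vecMulVec x y)
      = (Matrix.of fun (p : m × n) j => R p.1 j * x p.2)
        * (Matrix.of fun i (q : m × n) => (1 : Matrix m m ℂ) i q.1 * y q.2) := by
    ext ⟨i, k⟩ ⟨j, l⟩
    simp [Matrix.mul_apply, Matrix.vecMulVec_apply, Matrix.one_apply]
    ring
  rw [h1, Matrix.det_one_add_mul_comm]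
  congr 2
  ext i j
  simp only [Matrix.mul_apply, Matrix.of_apply, Matrix.smul_apply, smul_eq_mul, dotProduct,
    Fintype.sum_prod_type, Matrix.one_apply, Finset.sum_mul]
  rw [Finset.sum_eq_single i (fun k _ hk => by simp [hk.symm]) (by simp)]
  exact Finset.sum_congr rfl fun l _ => by rw [if_pos rfl]; ring

theorem det_one_add_smul_eq_prod {n : Type*} [Fintype n] [DecidableEq n] {R : Matrix n n ℂ}
    (hR : R.IsHermitian) (t : ℝ) :
    (1 + (t : ℂ) • R).det = ((∏ i, (1 + t * hR.eigenvalues i) : ℝ) : ℂ) := by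
  set U := hR.eigenvectorUnitary with hU
  have hUU : (U : Matrix n n ℂ) * star (U : Matrix n n ℂ) = 1 := Unitary.coe_mul_star_self U
  have h1 : 1 + (t : ℂ) • R = (U : Matrix n n ℂ)
      * Matrix.diagonal (fun i => ((1 + t * hR.eigenvalues i : ℝ) : ℂ))
      * star (U : Matrix n n ℂ) := by
    have hd : Matrix.diagonal (fun i => ((1 + t * hR.eigenvalues i : ℝ) : ℂ))
        = 1 + (t : ℂ) • Matrix.diagonal (RCLike.ofReal ∘ hR.eigenvalues) := by
      rw [← Matrix.diagonal_one, ← Matrix.diagonal_smul, Matrix.diagonal_add]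
      congr 1; funext i
      simp
    rw [hd, mul_add, add_mul, mul_one, hUU, mul_smul_comm, smul_mul_assoc]
    conv_lhs => rw [hR.spectral_theorem, Unitary.conjStarAlgAut_apply]
  rw [h1, Matrix.det_mul_right_comm, hUU, one_mul, Matrix.det_diagonal]
  push_cast
  rfl

end LinearAlgebra

/-! ### Energy of the waveform. -/

section Waveform

/-- The rows of `S` are orthogonal with energy `L`, so cross terms vanish and the factors add up to
`αN + αF = 1`: the random waveform has deterministic energy. -/
theorem sum_mul_conj_waveform {L : ℕ} {p αN αF : ℝ} (hp : 0 ≤ p) (hN : 0 ≤ αN) (hF : 0 ≤ αF)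
    (hα : αN + αF = 1) {S : Fin 2 → Fin L → ℂ}
    (hS : Matrix.of S * (Matrix.of S)ᴴ = (L : ℂ) • (1 : Matrix (Fin 2) (Fin 2) ℂ)) :
    star (waveform p αN αF S) ⬝ᵥ waveform p αN αF S = ((p * L : ℝ) : ℂ) := by
  have hS' : ∀ i j, ∑ l, S i l * conj (S j l) = if i = j then (L : ℂ) else 0 := fun i j => by
    have := congr_fun (congr_fun hS i) j
    simpa [Matrix.mul_apply, Matrix.one_apply] using this
  have e : ∀ l, star (waveform p αN αF S) l * waveform p αN αF S l
      = ((√p * √p : ℝ) : ℂ) * (((√αN * √αN : ℝ) : ℂ) * (S 0 l * conj (S 0 l))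
        + ((√αN * √αF : ℝ) : ℂ) * (S 0 l * conj (S 1 l))
        + ((√αN * √αF : ℝ) : ℂ) * (S 1 l * conj (S 0 l))
        + ((√αF * √αF : ℝ) : ℂ) * (S 1 l * conj (S 1 l))) := fun l => by
    simp only [waveform, Pi.star_apply, Pi.smul_apply, Matrix.vecMul, dotProduct, Fin.sum_univ_two,
      Matrix.of_apply, smul_eq_mul, ← starRingEnd_apply, map_mul, map_add, Complex.conj_ofReal,
      Matrix.cons_val_zero, Matrix.cons_val_one]
    push_cast
    ring
  simp only [dotProduct, e]
  rw [← Finset.mul_sum]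
  simp only [Finset.sum_add_distrib, ← Finset.mul_sum, hS']
  rw [Real.mul_self_sqrt hp, Real.mul_self_sqrt hN, Real.mul_self_sqrt hF]
  have : (αN : ℂ) + αF = 1 := by exact_mod_cast hα
  simp only [if_true, Fin.isValue, zero_ne_one, one_ne_zero, if_false]
  push_cast
  linear_combination (p * L : ℂ) * this

end Waveform

/-! ### High-power expansion. -/

section Asymptotics

/-- Dividing a factor with `λᵢ > 0` by `p c λᵢ` leaves `1 + (p c λᵢ)⁻¹ → 1`; factors with `λᵢ = 0`
equal `1`. -/
theorem tendsto_logb_prod_sub {n : Type*} [Fintype n] {lam : n → ℝ} (hlam : ∀ i, 0 ≤ lam i)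
    {c : ℝ} (hc : 0 < c) :
    Tendsto (fun p : ℝ => Real.logb 2 (∏ i, (1 + p * c * lam i))
      - ∑ i ∈ Finset.univ.filter (fun i => 0 < lam i),
          (Real.logb 2 p + Real.logb 2 (c * lam i))) atTop (𝓝 0) := by
  have key : ∀ i ∈ Finset.univ.filter (fun i => 0 < lam i),
      Tendsto (fun p : ℝ => Real.logb 2 (1 + (p * (c * lam i))⁻¹)) atTop (𝓝 0) := fun i hi => by
    have hi : 0 < lam i := (Finset.mem_filter.1 hi).2
    have h1 : Tendsto (fun p : ℝ => 1 + (p * (c * lam i))⁻¹) atTop (𝓝 (1 + 0)) :=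
      tendsto_const_nhds.add
        (tendsto_inv_atTop_zero.comp (tendsto_id.atTop_mul_const (mul_pos hc hi)))
    rw [add_zero] at h1
    have h2 := (Real.continuousAt_logb (b := 2) one_ne_zero).tendsto.comp h1
    rwa [Real.logb_one] at h2
  have hsum := tendsto_finsetSum _ key
  rw [Finset.sum_const_zero] at hsum
  refine hsum.congr' ?_
  filter_upwards [eventually_gt_atTop 0] with p hp
  have hne : ∀ i, 0 < 1 + p * c * lam i := fun i => by
    have := mul_nonneg (mul_pos hp hc).le (hlam i)
    linarith
  rw [Real.logb_prod Finset.univ _ (fun i _ => (hne i).ne'),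
    ← Finset.sum_filter_add_sum_filter_not Finset.univ (fun i => 0 < lam i), Finset.sum_eq_zero (s := Finset.univ.filter fun i => ¬ 0 < lam i),
    add_zero, ← Finset.sum_sub_distrib]
  · refine Finset.sum_congr rfl fun i hi => ?_
    have hi : 0 < lam i := (Finset.mem_filter.1 hi).2
    have hcl := mul_pos hc hi
    rw [← Real.logb_mul hp.ne' hcl.ne', ← Real.logb_div (hne i).ne' (mul_pos hp hcl).ne']
    congr 1
    field_simp
    ring
  · intro i hi
    have : lam i = 0 := le_antisymm (not_lt.1 (Finset.mem_filter.1 hi).2) (hlam i)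
    simp [this]

end Asymptotics

/-! ### The sensing channel. -/

section Channel

variable {Ω : Type*} [MeasurableSpace Ω] {P : Measure Ω}

theorem IsCircularGaussian.of_targetResponse {K M : ℕ} {β : Ω → Fin K → ℂ}
    {Γ : Matrix (Fin K) (Fin K) ℂ} (hβ : IsCircularGaussian P β Γ) (a : ℝ → Fin M → ℂ)
    (θ : Fin K → ℝ) :
    IsCircularGaussian P (fun ω => targetResponse a θ (β ω))
      (correlationMatrix P (fun ω => targetResponse a θ (β ω))) := by
  have e : (fun ω => targetResponse a θ (β ω))
      = fun ω => (Matrix.of fun m k => a (θ k) m) *ᵥ β ω := by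
    funext ω m
    simp [targetResponse, Matrix.mulVec, dotProduct, mul_comm]
  have h := hβ.mulVec (Matrix.of fun m k => a (θ k) m)
  rw [← e] at h
  exact ⟨h.gaussian, h.mean, h.pseudoCov, fun i j => rfl⟩

open scoped ComplexOrder in
-- `xᴴ C x` is the mean of `|xᴴ Z|²`.
theorem IsCircularGaussian.posSemidef {ι : Type*} [Fintype ι] {Z : Ω → ι → ℂ} {C : Matrix ι ι ℂ}
    (h : IsCircularGaussian P Z C) : C.PosSemidef := by
  have hC : C = correlationMatrix P Z := by
    ext i j
    exact (h.cov i j).symm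
  refine .of_dotProduct_mulVec_nonneg (hC ▸ correlationMatrix_isHermitian P Z) fun x => ?_
  have e : star x ⬝ᵥ C *ᵥ x = ∑ i, ∑ j, star x i * conj (star x j) * C i j := by
    simp only [dotProduct, Matrix.mulVec, Finset.mul_sum, Pi.star_apply, ← starRingEnd_apply,
      Complex.conj_conj]
    exact Finset.sum_congr rfl fun i _ => Finset.sum_congr rfl fun j _ => by ring
  rw [e, ← h.integral_sum_mul_conj_sum]
  simp_rw [Complex.mul_conj]
  rw [integral_complex_ofReal]
  exact Complex.zero_le_real.2 (integral_nonneg fun ω => Complex.normSq_nonneg _)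

theorem measurable_echo {M L : ℕ} :
    Measurable fun q : (Fin L → ℂ) × (Fin M → Fin L → ℂ) × (Fin M → ℂ) =>
      echo q.2.2 q.1 q.2.1 := by
  unfold echo
  fun_prop

variable {M L : ℕ} {σ : ℝ} {g : Ω → Fin M → ℂ} {N : Ω → Fin M → Fin L → ℂ}
  {R : Matrix (Fin M) (Fin M) ℂ}

open scoped ComplexOrder in
/-- The echo of a deterministic waveform has the law of a linear image of the noise, and the
squared modulus of the determinant of this linear map is `det (I + (‖x‖² / σ²) R)`. -/
theorem exists_map_echo_eq (hσ : 0 < σ) (hg : IsCircularGaussian P g R)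
    (hN : IsCircularGaussian P (fun ω (q : Fin M × Fin L) => N ω q.1 q.2)
      (((σ ^ 2 : ℝ) : ℂ) • (1 : Matrix (Fin M × Fin L) (Fin M × Fin L) ℂ)))
    (hgN : IndepFun g N P) (x : Fin L → ℂ) :
    ∃ A : (Fin M × Fin L → ℂ) →ₗ[ℝ] (Fin M × Fin L → ℂ),
      ((|LinearMap.det A| : ℝ) : ℂ) = (1 + ((star x ⬝ᵥ x) / ((σ ^ 2 : ℝ) : ℂ)) • R).det ∧
      P.map (fun ω (q : Fin M × Fin L) => echo (g ω) x (N ω) q.1 q.2)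
        = P.map (fun ω => A fun q => N ω q.1 q.2) := by
  set s : ℝ := σ ^ 2 with hs
  have hs0 : 0 < s := by positivity
  have hsC : (s : ℂ) ≠ 0 := by exact_mod_cast hs0.ne'
  set V : Matrix (Fin M × Fin L) (Fin M × Fin L) ℂ :=
    Matrix.kroneckerMap (· * ·) (s⁻¹ • R) (Matrix.vecMulVec x (star x)) with hV
  have hVpsd : V.PosSemidef := Matrix.PosSemidef.kronecker
    (hg.posSemidef.smul (inv_nonneg.2 hs0.le)) (Matrix.posSemidef_vecMulVec_self_star x)
  -- `V` is the signal covariance in units of the noise variance, so `A n` has covariance `s (I +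
  -- V)`, that of the echo.
  obtain ⟨A, hA⟩ := exists_eq_mul_conjTranspose_of_posSemidef (Matrix.PosSemidef.one.add hVpsd)
  refine ⟨(Matrix.toLin' A).restrictScalars ℝ, ?_, ?_⟩
  · rw [abs_det_restrictScalars_toLin', ← hA, hV, det_one_add_kronecker_vecMulVec]
    congr 2
    ext i j
    simp only [Matrix.smul_apply, smul_eq_mul, Complex.real_smul, Complex.ofReal_inv]
    field_simp
  -- `B = I ⊗ x`, so that `B g` is the flattened `g xᵀ`.
  · set B : Matrix (Fin M × Fin L) (Fin M) ℂ :=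
      Matrix.of fun q m => (1 : Matrix (Fin M) (Fin M) ℂ) q.1 m * x q.2 with hB
    have hflat : Measurable fun (n : Fin M → Fin L → ℂ) (q : Fin M × Fin L) => n q.1 q.2 := by
      fun_prop
    have hBm : Measurable fun v : Fin M → ℂ => B *ᵥ v := by
      unfold Matrix.mulVec dotProduct
      fun_prop
    have h1 := (hg.mulVec B).add hN (hgN.comp hBm hflat)
    have h2 := hN.mulVec A
    have hcov : B * R * Bᴴ + (s : ℂ) • (1 : Matrix (Fin M × Fin L) (Fin M × Fin L) ℂ)
        = A * ((s : ℂ) • (1 : Matrix (Fin M × Fin L) (Fin M × Fin L) ℂ)) * Aᴴ := by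
      rw [mul_smul_comm, mul_one, smul_mul_assoc, ← hA, smul_add, add_comm]
      congr 1
      ext ⟨i, k⟩ ⟨j, l⟩
      simp [hB, hV, Matrix.mul_apply, Matrix.vecMulVec_apply, Matrix.one_apply,
        apply_ite]
      field_simp
    rw [hcov] at h1
    have e : (fun ω (q : Fin M × Fin L) => echo (g ω) x (N ω) q.1 q.2)
        = fun ω => B *ᵥ g ω + fun q => N ω q.1 q.2 := by
      funext ω q
      simp [echo, hB, Matrix.mulVec, dotProduct, Matrix.one_apply, mul_comm]
    rw [e]
    exact h1.map_eq_map h2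

/-- The mutual information, in nats, between the echo of a deterministic waveform and the target
response. -/
theorem klDiv_echo (hσ : 0 < σ) (hg : IsCircularGaussian P g R)
    (hN : IsCircularGaussian P (fun ω (q : Fin M × Fin L) => N ω q.1 q.2)
      (((σ ^ 2 : ℝ) : ℂ) • (1 : Matrix (Fin M × Fin L) (Fin M × Fin L) ℂ)))
    (hgN : IndepFun g N P) {x : Fin L → ℂ} {d : ℝ} (hd : 0 < d)
    (hx : (1 + ((star x ⬝ᵥ x) / ((σ ^ 2 : ℝ) : ℂ)) • R).det = (d : ℂ)) :
    InformationTheory.klDiv (P.map fun ω => (echo (g ω) x (N ω), g ω))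
      ((P.map fun ω => echo (g ω) x (N ω)).prod (P.map g)) = ENNReal.ofReal (Real.log d) := by
  obtain ⟨A, hAdet, hAmap⟩ := exists_map_echo_eq hσ hg hN hgN x
  have hAd : |LinearMap.det A| = d := by exact_mod_cast hAdet.trans hx
  have := hg.gaussian.isProbabilityMeasure
  have hgm : AEMeasurable g P := hg.gaussian.aemeasurable
  set c := LinearEquiv.curry ℝ ℂ (Fin M) (Fin L) with hc
  have hcm : Measurable c := c.toContinuousLinearEquiv.continuous.measurable
  have hAm : Measurable A := A.continuous_of_finiteDimensional.measurable
  -- `A` conjugated by currying, from flat vectors to arrays; conjugation keeps the determinant.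
  set A' : (Fin M → Fin L → ℂ) →ₗ[ℝ] (Fin M → Fin L → ℂ) :=
    (c : _ →ₗ[ℝ] _) ∘ₗ A ∘ₗ (c.symm : _ →ₗ[ℝ] _) with hA'
  have hA'det : |LinearMap.det A'| = d := by rw [hA', LinearMap.det_conj, hAd]
  have hA'm : Measurable A' := A'.continuous_of_finiteDimensional.measurable
  have hNflat : AEMeasurable (fun ω (q : Fin M × Fin L) => N ω q.1 q.2) P :=
    hN.gaussian.aemeasurable
  have hNm : AEMeasurable N P := hcm.comp_aemeasurable hNflat
  have := Measure.isProbabilityMeasure_map hNm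
  have := Measure.isProbabilityMeasure_map hgm
  have hγ : HasFiniteEntropyDensity (P.map N) := by
    have := (hN.hasFiniteEntropyDensity (by positivity)).map_equiv c.toContinuousLinearEquiv
    exact (AEMeasurable.map_map_of_aemeasurable hcm.aemeasurable hNflat) ▸ this
  set h : (Fin M → ℂ) → Fin M → Fin L → ℂ := fun v m l => v m * x l with hh
  have hhm : Measurable h := by fun_prop
  have hprod : (P.map N).prod (P.map g) = P.map fun ω => (N ω, g ω) :=
    ((indepFun_iff_map_prod_eq_prod_map_map hNm hgm).1 hgN.symm).symm
  have hNg : AEMeasurable (fun ω => (N ω, g ω)) P := hNm.prodMk hgm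
  have hecho : AEMeasurable (fun ω => echo (g ω) x (N ω)) P :=
    (measurable_echo.comp (measurable_prodMk_left (x := x))).comp_aemeasurable hNg
  have hY1 : ((P.map N).prod (P.map g)).map (fun q => h q.2 + q.1)
      = P.map fun ω => echo (g ω) x (N ω) := by
    rw [hprod, AEMeasurable.map_map_of_aemeasurable (by fun_prop) hNg]
    rfl
  have hY2 : (P.map fun ω => echo (g ω) x (N ω)) = (P.map N).map A' := by
    have hflatm : Measurable fun (n : Fin M → Fin L → ℂ) (q : Fin M × Fin L) => n q.1 q.2 := by
      fun_prop
    have e1 := ((AEMeasurable.map_map_of_aemeasurable hcm.aemeasurable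
      (hflatm.comp_aemeasurable hecho)).symm.trans (congrArg (Measure.map c) hAmap)).trans
        (AEMeasurable.map_map_of_aemeasurable hcm.aemeasurable (hAm.comp_aemeasurable hNflat))
    rw [AEMeasurable.map_map_of_aemeasurable hA'm.aemeasurable hNm]
    exact e1
  have hJ : ((P.map N).prod (P.map g)).map (fun q => (h q.2 + q.1, q.2))
      = P.map fun ω => (echo (g ω) x (N ω), g ω) := by
    rw [hprod, AEMeasurable.map_map_of_aemeasurable (by fun_prop) hNg]
    rfl
  have key := klDiv_additive_noise hγ (P.map g) hhm A'
    (abs_pos.1 (hA'det ▸ hd)) (hY1.trans hY2)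
  rwa [hJ, ← hY2, hA'det] at key

theorem condMutualInfo_echo [IsProbabilityMeasure P] (hσ : 0 < σ) (hg : IsCircularGaussian P g R)
    (hN : IsCircularGaussian P (fun ω (q : Fin M × Fin L) => N ω q.1 q.2)
      (((σ ^ 2 : ℝ) : ℂ) • (1 : Matrix (Fin M × Fin L) (Fin M × Fin L) ℂ)))
    (hgN : IndepFun g N P) {X : Ω → Fin L → ℂ} (hX : AEMeasurable X P)
    (hXNg : IndepFun X (fun ω => (N ω, g ω)) P) {d : ℝ} (hd : 0 < d)
    (hXd : ∀ᵐ ω ∂P, (1 + ((star (X ω) ⬝ᵥ X ω) / ((σ ^ 2 : ℝ) : ℂ)) • R).det = (d : ℂ)) :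
    condMutualInfo P (fun ω => echo (g ω) (X ω) (N ω)) g X = ENNReal.ofReal (Real.log d) := by
  have hgm : AEMeasurable g P := hg.gaussian.aemeasurable
  have hcurry : Measurable fun (n : Fin M × Fin L → ℂ) m l => n (m, l) := by fun_prop
  have hNm : AEMeasurable N P := hcurry.comp_aemeasurable hN.gaussian.aemeasurable
  have hNg : AEMeasurable (fun ω => (N ω, g ω)) P := hNm.prodMk hgm
  have := Measure.isProbabilityMeasure_map hX
  have hdet : ∀ᵐ x ∂(P.map X), (1 + ((star x ⬝ᵥ x) / ((σ ^ 2 : ℝ) : ℂ)) • R).det = (d : ℂ) := by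
    refine (ae_map_iff hX ?_).2 hXd
    -- Transferring the almost sure identity to the law of `X` needs a measurable set; this one is
    -- closed because the determinant is continuous in `x`.
    refine (isClosed_eq ?_ continuous_const).measurableSet
    exact Continuous.matrix_det (continuous_const.add
      (((continuous_star.dotProduct continuous_id).div_const _).smul continuous_const))
  have hg2 : Measurable fun q : (Fin L → ℂ) × (Fin M → Fin L → ℂ) × (Fin M → ℂ) => q.2.2 := by
    fun_prop
  have k1 := condDistrib_comp_of_indepFun hX hNg hXNg (measurable_echo.prodMk hg2)
  have k2 := condDistrib_comp_of_indepFun hX hNg hXNg (measurable_echo (M := M) (L := L))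
  have k3 := condDistrib_comp_of_indepFun hX hNg hXNg hg2
  have key : ∀ᵐ x ∂(P.map X), InformationTheory.klDiv
      (condDistrib (fun ω => (echo (g ω) (X ω) (N ω), g ω)) X P x)
      ((condDistrib (fun ω => echo (g ω) (X ω) (N ω)) X P x).prod (condDistrib g X P x))
      = ENNReal.ofReal (Real.log d) := by
    filter_upwards [hdet, k1, k2, k3] with x hx h1 h2 h3
    rw [← klDiv_echo hσ hg hN hgN hd hx]
    have hm : Measurable fun w : (Fin M → Fin L → ℂ) × (Fin M → ℂ) => echo w.2 x w.1 :=
      measurable_echo.comp measurable_prodMk_left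
    replace h1 := h1.trans
      (AEMeasurable.map_map_of_aemeasurable (hm.prodMk measurable_snd).aemeasurable hNg)
    replace h2 := h2.trans (AEMeasurable.map_map_of_aemeasurable hm.aemeasurable hNg)
    replace h3 := h3.trans (AEMeasurable.map_map_of_aemeasurable measurable_snd.aemeasurable hNg)
    exact congrArg₂ _ h1 (congrArg₂ _ h2 h3)
  unfold condMutualInfo
  rw [lintegral_congr_ae key]
  simp

end Channel

end NomaIsac

/-! ### The sensing rate and its high-power asymptotics. -/

theorem theorem3 {Ω : Type*} [MeasurableSpace Ω] (P : Measure Ω) [IsProbabilityMeasure P]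
    (M L K : ℕ) (hL : 0 < L)
    -- power allocation factors of the near and the far user
    (αN αF : ℝ) (hαN : 0 ≤ αN) (hαNF : αN < αF) (hα : αN + αF = 1)
    -- noise variance
    (σ : ℝ) (hσ : 0 < σ)
    -- array steering vectors, angles of arrival, target amplitudes
    (a : ℝ → Fin M → ℂ) (θ : Fin K → ℝ)
    (β : Ω → Fin K → ℂ) (Γ : Matrix (Fin K) (Fin K) ℂ) (hβ : NomaIsac.IsCircularGaussian P β Γ)
    -- data streams with `S Sᴴ = L I₂`
    (S : Ω → Fin 2 → Fin L → ℂ) (hS : AEMeasurable S P)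
    (hSS : ∀ᵐ ω ∂P, Matrix.of (S ω) * (Matrix.of (S ω))ᴴ = (L : ℂ) • (1 : Matrix (Fin 2) (Fin 2) ℂ))
    -- white Gaussian noise with entries of variance `σ ^ 2`
    (N : Ω → Fin M → Fin L → ℂ)
    (hN : NomaIsac.IsCircularGaussian P (fun ω (q : Fin M × Fin L) => N ω q.1 q.2)
      (((σ ^ 2 : ℝ) : ℂ) • (1 : Matrix (Fin M × Fin L) (Fin M × Fin L) ℂ)))
    -- amplitudes, noise and data streams are mutually independent
    (hβN : IndepFun β N P) (hSβN : IndepFun S (fun ω => (β ω, N ω)) P)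
    (g : Ω → Fin M → ℂ) (hg : g = fun ω => NomaIsac.targetResponse a θ (β ω))
    (R : Matrix (Fin M) (Fin M) ℂ) (hR : R = NomaIsac.correlationMatrix P g)
    (lam : Fin M → ℝ)
    (hlam : lam = (hR ▸ NomaIsac.correlationMatrix_isHermitian P g : R.IsHermitian).eigenvalues)
    (rate : ℝ → ℝ≥0∞)
    (hrate : rate = fun p =>
      NomaIsac.sensingRate P g (fun ω => NomaIsac.waveform p αN αF (S ω)) N) :
    (∀ p : ℝ, 0 < p → rate p ≠ ∞ ∧
      ∃ d : ℝ, 0 < d ∧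
        (1 + ((p * L / σ ^ 2 : ℝ) : ℂ) • R).det = (d : ℂ) ∧
        (rate p).toReal = (L : ℝ)⁻¹ * Real.logb 2 d) ∧
    (Finset.univ.filter fun i => 0 < lam i).card = R.rank ∧
    Tendsto (fun p : ℝ => (rate p).toReal -
        ((R.rank : ℝ) / L * Real.logb 2 p +
          1 / L * ∑ i ∈ Finset.univ.filter (fun i => 0 < lam i),
            Real.logb 2 (L * lam i / σ ^ 2)))
      atTop (𝓝 0) 
:= by
  have hgG : NomaIsac.IsCircularGaussian P g R := by
    rw [hR, hg]
    exact hβ.of_targetResponse a θ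
  have hRh : R.IsHermitian := hR ▸ NomaIsac.correlationMatrix_isHermitian P g
  have hlam' : lam = hRh.eigenvalues := hlam
  have hlam0 : ∀ i, 0 ≤ lam i := by
    open scoped ComplexOrder in
    exact fun i => hlam' ▸ hgG.posSemidef.eigenvalues_nonneg i
  have hlog2 : 0 < Real.log 2 := Real.log_pos one_lt_two
  have hresp : Measurable fun b : Fin K → ℂ => NomaIsac.targetResponse a θ b := by
    unfold NomaIsac.targetResponse
    fun_prop
  have hgN : IndepFun g N P := by
    rw [hg]
    exact hβN.comp hresp measurable_id
  have hwave : ∀ p, Measurable (NomaIsac.waveform (L := L) p αN αF) := fun p => by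
    unfold NomaIsac.waveform Matrix.vecMul dotProduct
    simp only [Matrix.of_apply]
    fun_prop
  -- A product at least `1` has nonnegative logarithm, so `ENNReal.ofReal` does not truncate it.
  have hd1 : ∀ p, 0 < p → 1 ≤ ∏ i, (1 + p * (L / σ ^ 2) * lam i) := fun p hp =>
    Finset.one_le_prod fun i _ => by
      have := mul_nonneg (show 0 ≤ p * (L / σ ^ 2) by positivity) (hlam0 i)
      linarith
  have hdet : ∀ p, (1 + ((p * L / σ ^ 2 : ℝ) : ℂ) • R).det
      = ((∏ i, (1 + p * (L / σ ^ 2) * lam i) : ℝ) : ℂ) := fun p => by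
    rw [NomaIsac.det_one_add_smul_eq_prod hRh, hlam', mul_div_assoc]
  have hrateval : ∀ p, 0 < p → rate p = (L : ℝ≥0∞)⁻¹ *
      (ENNReal.ofReal (Real.log (∏ i, (1 + p * (L / σ ^ 2) * lam i)))
        / ENNReal.ofReal (Real.log 2)) := fun p hp => by
    rw [hrate]
    simp only [NomaIsac.sensingRate]
    have hX : AEMeasurable (fun ω => NomaIsac.waveform p αN αF (S ω)) P :=
      (hwave p).comp_aemeasurable hS
    rw [NomaIsac.condMutualInfo_echo hσ hgG hN hgN hX ?_
      (zero_lt_one.trans_le (hd1 p hp))]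
    · filter_upwards [hSS] with ω hω
      rw [NomaIsac.sum_mul_conj_waveform hp.le hαN (hαN.trans hαNF.le) hα hω, ← hdet,
        Complex.ofReal_div]
    · rw [hg]
      exact hSβN.comp (hwave p) (measurable_snd.prodMk (hresp.comp measurable_fst))
  have hreal : ∀ p, 0 < p → (rate p).toReal
      = (L : ℝ)⁻¹ * Real.logb 2 (∏ i, (1 + p * (L / σ ^ 2) * lam i)) := fun p hp => by
    rw [hrateval p hp, ENNReal.toReal_mul, ENNReal.toReal_inv, ENNReal.toReal_natCast,
      ENNReal.toReal_div, ENNReal.toReal_ofReal (Real.log_nonneg (hd1 p hp)),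
      ENNReal.toReal_ofReal hlog2.le, Real.logb]
  have hcard : (Finset.univ.filter fun i => 0 < lam i).card = R.rank := by
    rw [hRh.rank_eq_card_non_zero_eigs, Fintype.card_subtype]
    congr 1
    ext i
    simp only [Finset.mem_filter, Finset.mem_univ, true_and]
    rw [← hlam']
    exact (hlam0 i).lt_iff_ne'
  refine ⟨fun p hp => ⟨?_, _, zero_lt_one.trans_le (hd1 p hp), hdet p, hreal p hp⟩, hcard, ?_⟩
  · rw [hrateval p hp]
    refine ENNReal.mul_ne_top (ENNReal.inv_ne_top.2 (by exact_mod_cast hL.ne'))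
      (ENNReal.div_ne_top ENNReal.ofReal_ne_top (ENNReal.ofReal_pos.2 hlog2).ne')
  · have hT := (NomaIsac.tendsto_logb_prod_sub hlam0
      (show 0 < (L : ℝ) / σ ^ 2 by positivity)).const_mul (L : ℝ)⁻¹
    rw [mul_zero] at hT
    refine hT.congr' ?_
    filter_upwards [eventually_gt_atTop 0] with p hp
    rw [hreal p hp, Finset.sum_add_distrib, Finset.sum_const, hcard, nsmul_eq_mul]
    simp only [div_mul_eq_mul_div]
    ring
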